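/- Let $\Pi$ be the set of finite fractional power series $$\varphi(x,\xi)=\sum_{k=0}^{n_\varphi-1}a_kx^{1-k/m_\varphi}+\xi x^{1-n_\varphi/m_\varphi},\qquad a_k\in\mathbb{C},$$ with integers $m_\varphi\ge 1$, $n_\varphi\ge 0$ and a parameter $\xi$. (The denominator $m_\varphi$ may be any common denominator of the exponents; no coprimality normalization is required.) For $\psi,\varphi\in\Pi$ write $\psi\prec\varphi$ if $\varphi(x,\xi)=\psi(x,c+\text{lower terms in }x)$ for some constant $c\in\mathbb{C}$, where the lower terms are terms with negative exponents of $x$ and with coefficients in $\mathbb{C}[\xi]$. Let $f=(P,Q)$ with $P,Q\in\mathbb{C}[x,y]$, $\deg_yP=\deg P$ and $\deg_yQ=\deg Q$, and let $J(P,Q)=P_xQ_y-P_yQ_x$. For $\varphi\in\Pi$ write $$P(x,\varphi(x,\xi))=p_\varphi(\xi)x^{a_\varphi/m_\varphi}+\text{lower terms in }x,\qquad Q(x,\varphi(x,\xi))=q_\varphi(\xi)x^{b_\varphi/m_\varphi}+\text{lower terms in }x,$$ $$J(P,Q)(x,\varphi(x,\xi))=j_\varphi(\xi)x^{J_\varphi/m_\varphi}+\text{lower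 terms in }x,$$ with nonzero $p_\varphi,q_\varphi,j_\varphi\in\mathbb{C}[\xi]$ and integers $a_\varphi,b_\varphi,J_\varphi$. The series $\varphi$ is a horizontal series of $P$ (of $Q$) if $a_\varphi=0$ and $\deg p_\varphi>0$ (resp. $b_\varphi=0$ and $\deg q_\varphi>0$). It is a dicritical series of $f$ if it is a horizontal series of $P$ or of $Q$ and $\max\{a_\varphi,b_\varphi\}=0$. It is a singular series of $f$ if $\deg j_\varphi>0$ (if $J(P,Q)=0$, no series counts as singular). **Theorem.** Let $\psi\in\Pi$ with $a_\psi>0$, $b_\psi>0$ and $(a_\psi,b_\psi)=(Md,Me)$, where $M,d,e\in\mathbb{N}$ and $\gcd(d,e)=1$. Let $\varphi\in\Pi$ be a dicritical series of $f$ with $\psi\prec\varphi$. If $\psi$ is not a singular series of $f$, then (i) $(\deg p_\psi,\deg q_\psi)=(Nd,Ne)$ for some integer $N\ge 1$; (ii) $a_\varphi=b_\varphi=0$, and there are $C\in\mathbb{C}\setminus\{0\}$ and an integer $D\ge 1$ such that the leading terms of $p_\varphi$ and $q_\varphi$ are $\operatorname{Lcoeff}(p_\psi)\,C^d\xi^{Dd}$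 and $\operatorname{Lcoeff}(q_\psi)\,C^e\xi^{De}$, respectively, where $\operatorname{Lcoeff}(h)$ is the leading coefficient of $h\in\mathbb{C}[\xi]$. -/

import Mathlib

noncomputable section

namespace NewtonPuiseux

/-- Finite sums `∑ c_r(ξ) x^r` with rational exponents `r` and coefficients `c_r ∈ ℂ[ξ]`. -/
abbrev FracPoly : Type := AddMonoidAlgebra (Polynomial ℂ) ℚ

/-- The monomial `c(ξ) x^r`. -/
def mono (r : ℚ) (c : Polynomial ℂ) : FracPoly := AddMonoidAlgebra.single r c

/-- The set `Π` of finite fractional power series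
`φ(x, ξ) = ∑_{k < n} a_k x^(1 - k/m) + ξ x^(1 - n/m)` with parameter `ξ`.
The denominator `m` is any common denominator: no coprimality normalization of the
representation is imposed, so that in particular all normalized series are included. -/
structure Series where
  /-- the common denominator `m_φ` of the exponents -/
  m : ℕ
  m_pos : 0 < m
  /-- the index `n_φ` of the parameter term -/
  n : ℕ
  /-- the coefficients `a_k`, `k < n_φ` -/
  a : Fin n → ℂ

namespace Series

/-- `φ(x, η)`: the parameter is replaced by `η`. -/
def subst (φ : Series) (η : FracPoly) : FracPoly :=
  (∑ k : Fin φ.n, mono (1 - (k : ℚ) / φ.m) (Polynomial.C (φ.a k)))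
    + η * mono (1 - (φ.n : ℚ) / φ.m) 1

/-- `φ(x, ξ)` itself. -/
def toFracPoly (φ : Series) : FracPoly := φ.subst (mono 0 Polynomial.X)

/-- `ψ ≺ φ`: `φ(x, ξ) = ψ(x, c + lower terms in x)` with a constant `c ∈ ℂ`. -/
def Prec (ψ φ : Series) : Prop :=
  ∃ (c : ℂ) (η : FracPoly), (∀ r : ℚ, 0 ≤ r → η.coeff r = 0) ∧
    φ.toFracPoly = ψ.subst (mono 0 (Polynomial.C c) + η)

end Series

/-- `P(x, φ(x, ξ))`, where variable `0` is `x` and variable `1` is `y`. -/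
def along (P : MvPolynomial (Fin 2) ℂ) (φ : Series) : FracPoly :=
  MvPolynomial.aeval ![mono 1 1, φ.toFracPoly] P

/-- `P(x, φ(x, ξ)) = p(ξ) x^(a / m_φ) + lower terms in x`, with `0 ≠ p ∈ ℂ[ξ]`. -/
def HasLeadingTerm (P : MvPolynomial (Fin 2) ℂ) (φ : Series) (a : ℤ) (p : Polynomial ℂ) : Prop :=
  p ≠ 0 ∧ (along P φ).coeff ((a : ℚ) / φ.m) = p ∧
    ∀ r : ℚ, (a : ℚ) / φ.m < r → (along P φ).coeff r = 0

/-- The polynomial `P ∈ ℂ[x, y]` is monic in `y`, in the sense that `deg_y P = deg P`. -/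
def MonicInY (P : MvPolynomial (Fin 2) ℂ) : Prop :=
  MvPolynomial.degreeOf 1 P = MvPolynomial.totalDegree P

/-- The Jacobian determinant `J(P, Q) = P_x Q_y - P_y Q_x`. -/
def jacobian (P Q : MvPolynomial (Fin 2) ℂ) : MvPolynomial (Fin 2) ℂ :=
  MvPolynomial.pderiv 0 P * MvPolynomial.pderiv 1 Q
    - MvPolynomial.pderiv 1 P * MvPolynomial.pderiv 0 Q

/-- `φ` is a horizontal series of `P`: `a_φ = 0` and `deg p_φ > 0`. -/
def IsHorizontal (P : MvPolynomial (Fin 2) ℂ) (φ : Series) : Prop :=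
  ∃ p : Polynomial ℂ, HasLeadingTerm P φ 0 p ∧ 0 < p.natDegree

/-- `φ` is a dicritical series of `(P, Q)`: it is a horizontal series of `P` or of `Q`, and
`max {a_φ, b_φ} = 0`. -/
def IsDicritical (P Q : MvPolynomial (Fin 2) ℂ) (φ : Series) : Prop :=
  (IsHorizontal P φ ∨ IsHorizontal Q φ) ∧
    ∃ (a b : ℤ) (p q : Polynomial ℂ),
      HasLeadingTerm P φ a p ∧ HasLeadingTerm Q φ b q ∧ max a b = 0

/-- `φ` is a singular series of `(P, Q)`: `deg j_φ > 0`. -/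
def IsSingular (P Q : MvPolynomial (Fin 2) ℂ) (φ : Series) : Prop :=
  ∃ (J : ℤ) (j : Polynomial ℂ), HasLeadingTerm (jacobian P Q) φ J j ∧ 0 < j.natDegree

end NewtonPuiseux

end

/-!
The expansions `F = P(x, φ(x, ξ))` and `G = Q(x, φ(x, ξ))` are finite sums of monomials `x^r ξ^k`
with real `r`. Since `ψ ≺ φ`, one has `φ(x, ξ) = ψ(x, K(x) + ξ x^(-s₀))` with `s₀ > 0`
(`Series.Prec.exists_shift`), so that all the series between `ψ` and `φ` are seen by giving `x` and
`ξ` the weights `1` and `s`, `0 ≤ s ≤ s₀`, that is by the substitutions `ξ ↦ ξ x^s` (`scale`): the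
weight `s₀` gives the leading coefficients along `ψ` up to a translation of `ξ`, and the weight `0`
those along `φ`.

Let `f x^A` and `g x^B` be the leading terms of `F` and `G` at a weight `0 < s ≤ s₀`, with
`A, B > 0`. By the chain rule, `A f g' - B f' g` is zero or the leading coefficient of the Jacobian
at that weight. As `ψ` is not singular, the latter is a constant, at every such `s`. On the other
hand, `φ` is dicritical, so all exponents of `x` in `F` and `G` are nonpositive; as `A, B > 0`, each
monomial of `f` and `g` contains `ξ`, and `A f g' - B f' g` vanishes at `ξ = 0`. Hence it is zero
(`mul_derivative_eq_of_leads`). If moreover `A : B = d : e`, then `f^e` and `g^d` are proportional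
(`pow_proportional`). At `s = s₀` this is assertion (i).

For (ii), consider the corners of the Newton polygons: among the monomials of maximal weight, the
top (largest `k`) and the bottom one (smallest `k`). The claim is that the top corners of
`(F / Lcoeff p_ψ)^e` and `(G / Lcoeff q_ψ)^d` agree (`CornersMatch`) at `s = 0`. They agree at
`s₀`. If they agree at some `s > 0`, then by the proportionality of `f^e` and `g^d` the bottom
corners agree too, and these are the top corners at slightly smaller weights
(`CornersMatch.exists_lt`). As top corners are locally constant to the right, the infimum of the
weights where the top corners agree is attained, and so it is `0` (`CornersMatch.zero`). Positivity
of `A` along the way comes from the monomial `ξ^k`, `k > 0`, of `F`, if `φ` is horizontal for `P`,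
and that of `B` from `A : B = d : e`.
-/

noncomputable section

open Polynomial Filter Topology

namespace NewtonPuiseux

/-! ### Sums with real exponents and their leading coefficients -/

/-- Finite sums `∑ c_r(ξ) x^r` with real exponents `r` and coefficients `c_r ∈ ℂ[ξ]`. Real
exponents make room for the substitutions `ξ ↦ ξ x^s` with an arbitrary real weight `s`. -/
abbrev RealPoly : Type := AddMonoidAlgebra ℂ[X] ℝ

/-- The monomial `c(ξ) x^r`. -/
abbrev term (r : ℝ) (c : ℂ[X]) : RealPoly := AddMonoidAlgebra.single r c

/-- `F = f(ξ) x^A + lower terms in x`. The coefficient `f` is allowed to vanish, so that the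
notion is compatible with sums and products without side conditions. -/
def Leads (F : RealPoly) (A : ℝ) (f : ℂ[X]) : Prop :=
  F.coeff A = f ∧ ∀ r, A < r → F.coeff r = 0

lemma coeff_term (r : ℝ) (c : ℂ[X]) (B : ℝ) :
    (term r c).coeff B = if r = B then c else 0 := by
  classical
  simp [term, Finsupp.single_apply]

namespace Leads

variable {F G : RealPoly} {A B : ℝ} {f g : ℂ[X]}

lemma add (hF : Leads F A f) (hG : Leads G A g) : Leads (F + G) A (f + g) := by
  refine ⟨by simp [hF.1, hG.1], fun r hr => by simp [hF.2 r hr, hG.2 r hr]⟩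

lemma sub (hF : Leads F A f) (hG : Leads G A g) : Leads (F - G) A (f - g) := by
  refine ⟨by simp [hF.1, hG.1], fun r hr => by simp [hF.2 r hr, hG.2 r hr]⟩

lemma mono (hF : Leads F A f) (hAB : A < B) : Leads F B 0 :=
  ⟨hF.2 B hAB, fun r hr => hF.2 r (hAB.trans hr)⟩

lemma unique (hF : Leads F A f) (hf : f ≠ 0) (hG : Leads F B g) (hg : g ≠ 0) : A = B := by
  rcases lt_trichotomy A B with h | h | h
  · exact absurd (hG.1.symm.trans (hF.2 B h)) hg
  · exact h
  · exact absurd (hF.1.symm.trans (hG.2 A h)) hf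

lemma mul (hF : Leads F A f) (hG : Leads G B g) : Leads (F * G) (A + B) (f * g) := by
  classical
  have key : ∀ C, A + B ≤ C → (F * G).coeff C = if A + B = C then f * g else 0 := by
    intro C hC
    rw [AddMonoidAlgebra.coeff_mul, Finsupp.sum, Finset.sum_eq_single A]
    · rw [Finsupp.sum, Finset.sum_eq_single B]
      · rw [hF.1, hG.1]
      · intro b hb hne
        refine if_neg fun h => (Finsupp.mem_support_iff.1 hb) (hG.2 b ?_)
        exact lt_of_le_of_ne (by linarith) (Ne.symm hne)
      · intro h
        rw [Finsupp.notMem_support_iff.1 h]; simp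
    · intro a ha hne
      have haA : a < A := by
        rcases lt_trichotomy a A with h | h | h
        · exact h
        · exact absurd h hne
        · exact absurd (hF.2 a h) (Finsupp.mem_support_iff.1 ha)
      refine Finset.sum_eq_zero fun b hb => if_neg ?_
      have hbB : b ≤ B := by
        by_contra h
        exact (Finsupp.mem_support_iff.1 hb) (hG.2 b (not_le.1 h))
      intro h; linarith
    · intro h
      rw [Finsupp.notMem_support_iff.1 h]; simp [Finsupp.sum]
  exact ⟨by rw [key _ le_rfl, if_pos rfl], fun r hr => by rw [key r hr.le, if_neg hr.ne]⟩

end Leads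

lemma leads_term (A : ℝ) (f : ℂ[X]) : Leads (term A f) A f := by
  refine ⟨by simp, fun r hr => by simp [hr.ne]⟩

lemma exists_leads {F : RealPoly} (hF : F ≠ 0) : ∃ A f, f ≠ 0 ∧ Leads F A f := by
  have hs : F.coeff.support.Nonempty := by
    rw [Finsupp.support_nonempty_iff]
    exact fun h => hF (AddMonoidAlgebra.coeff_eq_zero.1 h)
  refine ⟨F.coeff.support.max' hs, _, ?_, rfl, fun r hr => ?_⟩
  · exact Finsupp.mem_support_iff.1 (Finset.max'_mem _ hs)
  · by_contra h
    exact absurd (Finset.le_max' _ r (Finsupp.mem_support_iff.2 h)) (not_le.2 hr)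

/-! ### Substitutions for the parameter -/

/-- The substitution `ξ ↦ ζ`, with `x` fixed. -/
def substParam (ζ : RealPoly) : RealPoly →ₐ[ℂ] RealPoly :=
  AddMonoidAlgebra.liftNCAlgHom (aeval ζ) (AddMonoidAlgebra.of ℂ[X] ℝ) fun _ _ => Commute.all _ _

lemma substParam_term (ζ : RealPoly) (r : ℝ) (c : ℂ[X]) :
    substParam ζ (term r c) = aeval ζ c * term r 1 := by
  simp only [substParam, AddMonoidAlgebra.coe_liftNCAlgHom]
  exact AddMonoidAlgebra.liftNC_single _ _ _ _

lemma Leads.aeval {ζ : RealPoly} {z : ℂ[X]} (hζ : Leads ζ 0 z) (p : ℂ[X]) :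
    Leads (aeval ζ p) 0 (p.comp z) := by
  induction p using Polynomial.induction_on with
  | C a =>
    rw [aeval_C, C_comp]
    exact leads_term 0 (C a)
  | add p q hp hq => simpa using hp.add hq
  | monomial n a h =>
    have := h.mul hζ
    simp only [add_zero] at this
    convert this using 1
    · simp [pow_succ, mul_assoc]
    · simp [pow_succ, mul_assoc]

/-- If all exponents of `ζ` are nonpositive, then the substitution `ξ ↦ ζ` acts on leading
coefficients through the constant term of `ζ`. -/
lemma Leads.substParam {ζ : RealPoly} {z : ℂ[X]} (hζ : Leads ζ 0 z) {F : RealPoly} {A : ℝ}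
    {f : ℂ[X]} (hF : Leads F A f) : Leads (substParam ζ F) A (f.comp z) := by
  obtain ⟨rfl, hF⟩ := hF
  have hsum : F = ∑ r ∈ F.coeff.support, term r (F.coeff r) :=
    (AddMonoidAlgebra.sum_coeff_single F).symm
  have hterm : ∀ (r : ℝ) (c : ℂ[X]),
      Leads (NewtonPuiseux.substParam ζ (term r c)) r (c.comp z) := by
    intro r c
    rw [substParam_term]
    simpa using (hζ.aeval c).mul (leads_term r 1)
  have key : ∀ B, A ≤ B → (NewtonPuiseux.substParam ζ F).coeff B = (F.coeff B).comp z := by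
    intro B hB
    conv_lhs => rw [hsum]
    rw [map_sum, AddMonoidAlgebra.coeff_sum, Finsupp.finsetSum_apply, Finset.sum_eq_single B]
    · exact (hterm _ _).1
    · intro r hr hrB
      refine (hterm r _).2 B (lt_of_le_of_ne (le_trans ?_ hB) hrB)
      by_contra h
      exact (Finsupp.mem_support_iff.1 hr) (hF r (not_le.1 h))
    · intro h
      rw [Finsupp.notMem_support_iff.1 h, show term B 0 = 0 from AddMonoidAlgebra.single_zero _]
      simp
  exact ⟨key A le_rfl, fun r hr => by rw [key r hr.le, hF r hr, zero_comp]⟩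

/-- The substitution `ξ ↦ ξ x^s`. -/
abbrev scale (s : ℝ) : RealPoly →ₐ[ℂ] RealPoly := substParam (term s X)

lemma scale_term (s r : ℝ) (k : ℕ) (a : ℂ) :
    scale s (term r (monomial k a)) = term (r + s * k) (monomial k a) := by
  rw [substParam_term, aeval_monomial, term, AddMonoidAlgebra.single_pow]
  rw [show algebraMap ℂ RealPoly a = AddMonoidAlgebra.single 0 (C a) from rfl]
  simp only [AddMonoidAlgebra.single_mul_single, mul_one, C_mul_X_pow_eq_monomial]
  congr 1
  simp; ring

/-- The coefficient of `x^r ξ^k`. -/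
def bicoeff (F : RealPoly) (r : ℝ) (k : ℕ) : ℂ := (F.coeff r).coeff k

lemma bicoeff_scale (s : ℝ) (F : RealPoly) (A : ℝ) (k : ℕ) :
    bicoeff (scale s F) A k = bicoeff F (A - s * k) k := by
  induction F using AddMonoidAlgebra.induction_linear with
  | zero => simp [bicoeff]
  | add F G hF hG => simp only [bicoeff, map_add, AddMonoidAlgebra.coeff_add, Finsupp.add_apply,
      coeff_add] at *; rw [hF, hG]
  | single r c =>
    induction c using Polynomial.induction_on' with
    | add p q hp hq =>
      simp only [bicoeff, AddMonoidAlgebra.single_add, map_add, AddMonoidAlgebra.coeff_add,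
        Finsupp.add_apply, coeff_add] at *
      rw [hp, hq]
    | monomial n a =>
      change bicoeff (scale s (term r (monomial n a))) A k = bicoeff (term r (monomial n a)) _ k
      rw [scale_term, bicoeff, bicoeff, coeff_term, coeff_term]
      by_cases hk : n = k
      · subst hk
        simp only [eq_sub_iff_add_eq]
      · split_ifs <;> simp [coeff_monomial, hk]

/-! ### Derivations and the Jacobian -/

/-- The derivation `∑ c_r x^r ↦ ∑ D_r(c_r) x^r` given by a compatible family of operators on the
coefficients. -/
def diagDerivation (D : ℝ → ℂ[X] →ₗ[ℂ] ℂ[X])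
    (hD : ∀ r s a b, D (r + s) (a * b) = a * D s b + b * D r a) :
    Derivation ℂ RealPoly RealPoly :=
  Derivation.mk'
    { toFun := fun F => .ofCoeff (Finsupp.onFinset F.coeff.support (fun r => D r (F.coeff r))
        fun r hr => Finsupp.mem_support_iff.2 fun h => hr (by rw [h, map_zero]))
      map_add' := fun F G => by ext1; ext1 r; simp
      map_smul' := fun a F => by ext1; ext1 r; simp } <| by
    intro F G
    have hsingle : ∀ (r : ℝ) (c : ℂ[X]) (H),
        (AddMonoidAlgebra.ofCoeff (Finsupp.onFinset (term r c).coeff.support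
          (fun t => D t ((term r c).coeff t)) H) : RealPoly) = term r (D r c) := by
      intro r c H
      ext1; ext1 t
      simp only [coeff_term, Finsupp.onFinset_apply]
      split_ifs with h
      · rw [h]
      · rw [map_zero]
    induction F using AddMonoidAlgebra.induction_linear with
    | zero => rw [zero_mul, map_zero, smul_zero, add_zero, zero_smul]
    | add F F' hF hF' =>
      rw [add_mul, map_add, hF, hF', map_add]
      simp only [smul_eq_mul]; ring
    | single r c =>
      induction G using AddMonoidAlgebra.induction_linear with
      | zero => rw [mul_zero, map_zero, smul_zero, zero_add, zero_smul]
      | add G G' hG hG' =>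
        rw [mul_add, map_add, hG, hG', map_add]
        simp only [smul_eq_mul]; ring
      | single s b =>
        rw [AddMonoidAlgebra.single_mul_single]
        simp only [LinearMap.coe_mk, AddHom.coe_mk, smul_eq_mul]
        rw [hsingle, hsingle, hsingle]
        simp only [term, AddMonoidAlgebra.single_mul_single]
        rw [hD, AddMonoidAlgebra.single_add, add_comm s r]

lemma coeff_diagDerivation (D : ℝ → ℂ[X] →ₗ[ℂ] ℂ[X]) (hD) (F : RealPoly) (r : ℝ) :
    (diagDerivation D hD F).coeff r = D r (F.coeff r) := rfl

/-- The Euler derivation `x ∂/∂x`. -/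
def euler : Derivation ℂ RealPoly RealPoly :=
  diagDerivation (fun r => (r : ℂ) • LinearMap.id) fun r s a b => by
    simp only [LinearMap.smul_apply, LinearMap.id_apply, smul_eq_C_mul, Complex.ofReal_add, C_add]
    ring

/-- The derivation `∂/∂ξ`. -/
def paramDeriv : Derivation ℂ RealPoly RealPoly :=
  diagDerivation (fun _ => derivative) fun r s a b => by
    rw [derivative_mul]; ring

lemma Leads.euler {F : RealPoly} {A : ℝ} {f : ℂ[X]} (hF : Leads F A f) :
    Leads (euler F) A (C (A : ℂ) * f) := by
  refine ⟨?_, fun r hr => ?_⟩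
  · simp [NewtonPuiseux.euler, coeff_diagDerivation, hF.1, smul_eq_C_mul]
  · simp [NewtonPuiseux.euler, coeff_diagDerivation, hF.2 r hr]

lemma Leads.paramDeriv {F : RealPoly} {A : ℝ} {f : ℂ[X]} (hF : Leads F A f) :
    Leads (paramDeriv F) A (derivative f) := by
  refine ⟨?_, fun r hr => ?_⟩
  · simp [NewtonPuiseux.paramDeriv, coeff_diagDerivation, hF.1]
  · simp [NewtonPuiseux.paramDeriv, coeff_diagDerivation, hF.2 r hr]

lemma euler_term (r : ℝ) (c : ℂ[X]) : euler (term r c) = term r (C (r : ℂ) * c) := by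
  ext1; ext1 t
  simp only [euler, coeff_diagDerivation, coeff_term]
  split_ifs with h
  · simp [h, smul_eq_C_mul]
  · simp

lemma paramDeriv_term (r : ℝ) (c : ℂ[X]) : paramDeriv (term r c) = term r (derivative c) := by
  ext1; ext1 t
  simp only [paramDeriv, coeff_diagDerivation, coeff_term]
  split_ifs with h <;> simp

lemma derivation_aeval {R : Type*} [CommRing R] [Algebra ℂ R] (D : Derivation ℂ R R)
    (u : Fin 2 → R) (P : MvPolynomial (Fin 2) ℂ) :
    D (MvPolynomial.aeval u P) = MvPolynomial.aeval u (MvPolynomial.pderiv 0 P) * D (u 0)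
      + MvPolynomial.aeval u (MvPolynomial.pderiv 1 P) * D (u 1) := by
  induction P using MvPolynomial.induction_on with
  | C a => simp
  | add p q hp hq => simp only [map_add, hp, hq]; ring
  | mul_X p i hp =>
    simp only [map_mul, MvPolynomial.aeval_X, Derivation.leibniz, hp, smul_eq_mul, map_add,
      MvPolynomial.pderiv_X]
    fin_cases i <;> simp <;> ring

/-- The chain rule for the Jacobian under `(x, ξ) ↦ (x, v(x, ξ))`. -/
lemma jacobian_chain (P Q : MvPolynomial (Fin 2) ℂ) (v : RealPoly) :
    euler (MvPolynomial.aeval ![term 1 1, v] P) * paramDeriv (MvPolynomial.aeval ![term 1 1, v] Q)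
      - paramDeriv (MvPolynomial.aeval ![term 1 1, v] P)
        * euler (MvPolynomial.aeval ![term 1 1, v] Q)
      = MvPolynomial.aeval ![term 1 1, v] (jacobian P Q) * (term 1 1 * paramDeriv v) := by
  have h0 : paramDeriv (term 1 1) = 0 := by
    rw [paramDeriv_term]; simp
  have h1 : euler (term 1 1) = term 1 1 := by
    rw [euler_term]; simp
  simp only [derivation_aeval, jacobian, map_sub, map_mul, Matrix.cons_val_zero,
    Matrix.cons_val_one, h0, h1]
  ring

lemma Leads.wronskian {F G : RealPoly} {A B : ℝ} {f g : ℂ[X]} (hF : Leads F A f)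
    (hG : Leads G B g) :
    Leads (NewtonPuiseux.euler F * NewtonPuiseux.paramDeriv G
      - NewtonPuiseux.paramDeriv F * NewtonPuiseux.euler G) (A + B)
      (C (A : ℂ) * f * derivative g - derivative f * (C (B : ℂ) * g)) :=
  (hF.euler.mul hG.paramDeriv).sub (hF.paramDeriv.mul hG.euler)

/-! ### Polynomials with proportional logarithmic derivatives -/

lemma natDegree_eq_of_derivative_mul_eq {u v : ℂ[X]} (hu : u ≠ 0) (hv : v ≠ 0)
    (h : derivative u * v = u * derivative v) : u.natDegree = v.natDegree := by
  have key : ∀ p : ℂ[X], (X * derivative p).natDegree ≤ p.natDegree ∧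
      (X * derivative p).coeff p.natDegree = p.natDegree * p.leadingCoeff := by
    intro p
    have hc : ∀ n, (X * derivative p).coeff n = n * p.coeff n := by
      rintro (_ | n)
      · simp
      · rw [coeff_X_mul, coeff_derivative]; push_cast; ring
    refine ⟨natDegree_le_iff_coeff_eq_zero.2 fun n hn => ?_, hc _⟩
    rw [hc, coeff_eq_zero_of_natDegree_lt hn, mul_zero]
  have h1 : (X * derivative u) * v = u * (X * derivative v) := by
    linear_combination X * h
  have h2 := congrArg (fun p => p.coeff (u.natDegree + v.natDegree)) h1
  rw [coeff_mul_add_eq_of_natDegree_le (key u).1 le_rfl,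
    coeff_mul_add_eq_of_natDegree_le le_rfl (key v).1, (key u).2, (key v).2] at h2
  have h3 : (u.leadingCoeff * v.leadingCoeff) * ((u.natDegree : ℂ) - v.natDegree) = 0 := by
    simp only [coeff_natDegree] at h2
    linear_combination h2
  rcases mul_eq_zero.1 h3 with h3 | h3
  · exact absurd h3 (mul_ne_zero (leadingCoeff_ne_zero.2 hu) (leadingCoeff_ne_zero.2 hv))
  · exact_mod_cast sub_eq_zero.1 h3

lemma proportional_of_derivative_mul_eq {u v : ℂ[X]} (hu : u ≠ 0) (hv : v ≠ 0)
    (h : derivative u * v = u * derivative v) :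
    C v.leadingCoeff * u = C u.leadingCoeff * v := by
  have hdeg := natDegree_eq_of_derivative_mul_eq hu hv h
  by_contra hne
  set w := C v.leadingCoeff * u - C u.leadingCoeff * v with hw
  have hw0 : w ≠ 0 := sub_ne_zero.2 hne
  have hwv : derivative w * v = w * derivative v := by
    simp only [hw, derivative_sub, derivative_C_mul]
    linear_combination C v.leadingCoeff * h
  have hwdeg := natDegree_eq_of_derivative_mul_eq hw0 hv hwv
  -- the top coefficients of the two terms of `w` cancel, so `w` has too small a degree
  apply hw0
  rw [← leadingCoeff_eq_zero, leadingCoeff, hwdeg, hw, coeff_sub, coeff_C_mul, coeff_C_mul,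
    ← hdeg, coeff_natDegree, hdeg, coeff_natDegree]
  ring

lemma pow_proportional {f g : ℂ[X]} {d e : ℕ} (hd : 0 < d) (he : 0 < e) (hf : f ≠ 0) (hg : g ≠ 0)
    (h : C (d : ℂ) * f * derivative g = derivative f * (C (e : ℂ) * g)) :
    C (g.leadingCoeff ^ d) * f ^ e = C (f.leadingCoeff ^ e) * g ^ d := by
  have := proportional_of_derivative_mul_eq (pow_ne_zero e hf) (pow_ne_zero d hg) (by
    obtain ⟨d, rfl⟩ := Nat.exists_eq_succ_of_ne_zero hd.ne'
    obtain ⟨e, rfl⟩ := Nat.exists_eq_succ_of_ne_zero he.ne'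
    rw [derivative_pow, derivative_pow]
    simp only [Nat.succ_sub_one, Nat.succ_eq_add_one]
    linear_combination (-(f ^ e * g ^ d)) * h)
  rwa [leadingCoeff_pow, leadingCoeff_pow] at this

lemma trailingCoeff_pow' (p : ℂ[X]) (n : ℕ) : (p ^ n).trailingCoeff = p.trailingCoeff ^ n := by
  induction n with
  | zero => simp [trailingCoeff, natTrailingDegree_one]
  | succ n ih => rw [pow_succ, trailingCoeff_mul, ih, pow_succ]

lemma natTrailingDegree_pow' {p : ℂ[X]} (hp : p ≠ 0) (n : ℕ) :
    (p ^ n).natTrailingDegree = n * p.natTrailingDegree := by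
  induction n with
  | zero => simp
  | succ n ih => rw [pow_succ, natTrailingDegree_mul (pow_ne_zero _ hp) hp, ih]; ring

/-- If `β f^e = α g^d` with constants `α, β ≠ 0`, then the lowest terms of `f` and `g` satisfy the
same relation. -/
lemma trailing_of_pow_proportional {f g : ℂ[X]} {d e : ℕ} {α β : ℂ} (hf : f ≠ 0) (hg : g ≠ 0)
    (hα : α ≠ 0) (hβ : β ≠ 0) (h : C β * f ^ e = C α * g ^ d) :
    e * f.natTrailingDegree = d * g.natTrailingDegree ∧
      β * f.trailingCoeff ^ e = α * g.trailingCoeff ^ d := by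
  have hC : ∀ a : ℂ, (C a : ℂ[X]).trailingCoeff = a := fun a => by
    rw [trailingCoeff, natTrailingDegree_C, coeff_C_zero]
  constructor
  · have := congrArg natTrailingDegree h
    rwa [natTrailingDegree_mul (C_ne_zero.2 hβ) (pow_ne_zero _ hf),
      natTrailingDegree_mul (C_ne_zero.2 hα) (pow_ne_zero _ hg), natTrailingDegree_C,
      natTrailingDegree_C, zero_add, zero_add, natTrailingDegree_pow' hf,
      natTrailingDegree_pow' hg] at this
  · have := congrArg trailingCoeff h
    rwa [trailingCoeff_mul, trailingCoeff_mul, trailingCoeff_pow', trailingCoeff_pow', hC,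
      hC] at this

/-! ### Corners of the Newton polygon -/

/-- With the weights `(1, s)` on `(x, ξ)`, the monomial `x^r ξ^k` is, among those of maximal weight
in `F`, the one with the largest `k`. -/
def IsTop (s : ℝ) (F : RealPoly) (r : ℝ) (k : ℕ) : Prop :=
  bicoeff F r k ≠ 0 ∧ ∀ r' k', bicoeff F r' k' ≠ 0 →
    r' + s * k' < r + s * k ∨ r' + s * k' = r + s * k ∧ k' ≤ k

/-- With the weights `(1, s)` on `(x, ξ)`, the monomial `x^r ξ^k` is, among those of maximal weight
in `F`, the one with the smallest `k`. -/
def IsBottom (s : ℝ) (F : RealPoly) (r : ℝ) (k : ℕ) : Prop :=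
  bicoeff F r k ≠ 0 ∧ ∀ r' k', bicoeff F r' k' ≠ 0 →
    r' + s * k' < r + s * k ∨ r' + s * k' = r + s * k ∧ k ≤ k'

lemma finite_bisupport (F : RealPoly) : {m : ℝ × ℕ | bicoeff F m.1 m.2 ≠ 0}.Finite := by
  refine (Set.Finite.subset ((F.coeff.support ×ˢ
    (F.coeff.support.sup fun r => (F.coeff r).support) : Finset (ℝ × ℕ)).finite_toSet) ?_)
  rintro ⟨r, k⟩ h
  have hr : r ∈ F.coeff.support := Finsupp.mem_support_iff.2 fun h0 => h (by simp [bicoeff, h0])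
  simp only [Finset.coe_product, Set.mem_prod, Finset.mem_coe]
  refine ⟨hr, Finset.mem_sup.2 ⟨r, hr, mem_support_iff.2 h⟩⟩

lemma IsTop.unique {s : ℝ} {F : RealPoly} {r r' : ℝ} {k k' : ℕ} (h : IsTop s F r k)
    (h' : IsTop s F r' k') : r = r' ∧ k = k' := by
  have h1 := h.2 r' k' h'.1
  have h2 := h'.2 r k h.1
  have hw : r' + s * k' = r + s * k := by
    rcases h1 with h1 | h1 <;> rcases h2 with h2 | h2 <;> linarith [h1, h2]
  have hk : k = k' := by
    rcases h1 with h1 | h1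
    · linarith
    · rcases h2 with h2 | h2
      · linarith
      · omega
  subst hk
  exact ⟨by linarith, rfl⟩

lemma IsTop.eventually {s : ℝ} {F : RealPoly} {r : ℝ} {k : ℕ} (h : IsTop s F r k) :
    ∀ᶠ t in 𝓝[>] s, IsTop t F r k := by
  have key : ∀ᶠ t in 𝓝[>] s, ∀ m ∈ {m : ℝ × ℕ | bicoeff F m.1 m.2 ≠ 0},
      m.1 + t * m.2 < r + t * k ∨ m.1 + t * m.2 = r + t * k ∧ m.2 ≤ k := by
    rw [Filter.eventually_all_finite (finite_bisupport F)]
    rintro ⟨r', k'⟩ hm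
    rcases h.2 r' k' hm with hlt | ⟨heq, hk⟩
    · have : ∀ᶠ t in 𝓝 s, r' + t * k' < r + t * k :=
        ContinuousAt.eventually_lt (by fun_prop) (by fun_prop) hlt
      exact (this.filter_mono nhdsWithin_le_nhds).mono fun t ht => Or.inl ht
    · filter_upwards [self_mem_nhdsWithin] with t ht
      rcases hk.lt_or_eq with hk | rfl
      · left
        have : (k' : ℝ) < k := by exact_mod_cast hk
        have ht : s < t := ht
        nlinarith
      · right
        exact ⟨by linarith, le_rfl⟩
  exact key.mono fun t ht => ⟨h.1, fun r' k' hm => ht (r', k') hm⟩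

lemma IsBottom.eventually {s : ℝ} {F : RealPoly} {r : ℝ} {k : ℕ} (h : IsBottom s F r k) :
    ∀ᶠ t in 𝓝[<] s, IsTop t F r k := by
  have key : ∀ᶠ t in 𝓝[<] s, ∀ m ∈ {m : ℝ × ℕ | bicoeff F m.1 m.2 ≠ 0},
      m.1 + t * m.2 < r + t * k ∨ m.1 + t * m.2 = r + t * k ∧ m.2 ≤ k := by
    rw [Filter.eventually_all_finite (finite_bisupport F)]
    rintro ⟨r', k'⟩ hm
    rcases h.2 r' k' hm with hlt | ⟨heq, hk⟩
    · have : ∀ᶠ t in 𝓝 s, r' + t * k' < r + t * k :=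
        ContinuousAt.eventually_lt (by fun_prop) (by fun_prop) hlt
      exact (this.filter_mono nhdsWithin_le_nhds).mono fun t ht => Or.inl ht
    · filter_upwards [self_mem_nhdsWithin] with t ht
      rcases hk.lt_or_eq with hk | rfl
      · left
        have : (k : ℝ) < k' := by exact_mod_cast hk
        have ht : t < s := ht
        nlinarith
      · right
        exact ⟨by linarith, le_rfl⟩
  exact key.mono fun t ht => ⟨h.1, fun r' k' hm => ht (r', k') hm⟩

section Corners

variable {s A : ℝ} {F : RealPoly} {f : ℂ[X]}

/-- The leading coefficient after `ξ ↦ ξ x^s` collects the coefficients of the monomials of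
maximal weight. -/
lemma coeff_of_leads_scale (h : Leads (scale s F) A f) (k : ℕ) :
    f.coeff k = bicoeff F (A - s * k) k := by
  rw [← bicoeff_scale, bicoeff, h.1]

lemma weight_le_of_leads_scale (h : Leads (scale s F) A f) {r : ℝ} {k : ℕ}
    (hr : bicoeff F r k ≠ 0) : r + s * k ≤ A := by
  by_contra hlt
  apply hr
  have := bicoeff_scale s F (r + s * k) k
  rw [add_sub_cancel_right] at this
  rw [← this, bicoeff, h.2 _ (not_le.1 hlt), coeff_zero]

lemma isTop_of_leads_scale (h : Leads (scale s F) A f) (hf : f ≠ 0) :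
    IsTop s F (A - s * f.natDegree) f.natDegree := by
  refine ⟨?_, fun r k hr => ?_⟩
  · rw [← coeff_of_leads_scale h]
    exact leadingCoeff_ne_zero.2 hf
  · rw [sub_add_cancel]
    rcases (weight_le_of_leads_scale h hr).lt_or_eq with hlt | heq
    · exact Or.inl hlt
    · refine Or.inr ⟨heq, le_natDegree_of_ne_zero ?_⟩
      rwa [coeff_of_leads_scale h, ← heq, add_sub_cancel_right]

lemma isBottom_of_leads_scale (h : Leads (scale s F) A f) (hf : f ≠ 0) :
    IsBottom s F (A - s * f.natTrailingDegree) f.natTrailingDegree := by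
  refine ⟨?_, fun r k hr => ?_⟩
  · rw [← coeff_of_leads_scale h]
    exact trailingCoeff_nonzero_iff_nonzero.2 hf
  · rw [sub_add_cancel]
    rcases (weight_le_of_leads_scale h hr).lt_or_eq with hlt | heq
    · exact Or.inl hlt
    · refine Or.inr ⟨heq, natTrailingDegree_le_of_ne_zero ?_⟩
      rwa [coeff_of_leads_scale h, ← heq, add_sub_cancel_right]

lemma scale_zero (F : RealPoly) : scale 0 F = F := by
  ext1; ext1 r; ext k
  have := bicoeff_scale 0 F r k
  simpa [bicoeff] using this

lemma scale_ne_zero (hF : F ≠ 0) : scale s F ≠ 0 := by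
  intro h
  apply hF
  ext1; ext1 r; ext k
  have := bicoeff_scale s F (r + s * k) k
  rw [h, add_sub_cancel_right] at this
  simpa [bicoeff] using this.symm

end Corners

/-! ### Descent along the weights -/

/-- The top corners of `F` and `G` for the weights `(1, s)` have exponents in the ratio `d : e`,
and their coefficients `u`, `v` satisfy `β^d u^e = α^e v^d`. In other words, `(F / α)^e` and
`(G / β)^d` have the same top corner. -/
def CornersMatch (d e : ℕ) (α β : ℂ) (F G : RealPoly) (s : ℝ) : Prop :=
  ∃ r k r' k', IsTop s F r k ∧ IsTop s G r' k' ∧ (e : ℝ) * r = d * r' ∧ e * k = d * k' ∧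
    β ^ d * bicoeff F r k ^ e = α ^ e * bicoeff G r' k' ^ d

section Descent

variable {d e : ℕ} {α β : ℂ} {F G : RealPoly}

lemma IsTop.leads {s r : ℝ} {k : ℕ} (h : IsTop s F r k) :
    ∃ f : ℂ[X], f ≠ 0 ∧ Leads (scale s F) (r + s * k) f ∧ f.natDegree = k ∧
      f.leadingCoeff = bicoeff F r k := by
  have hF : F ≠ 0 := by
    rintro rfl
    exact h.1 (by simp [bicoeff])
  obtain ⟨A, f, hf, hA⟩ := exists_leads (scale_ne_zero (s := s) hF)
  obtain ⟨hr, hk⟩ := h.unique (isTop_of_leads_scale hA hf)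
  have hrA : r + s * k = A := by rw [hr, hk]; ring
  refine ⟨f, hf, hrA ▸ hA, hk.symm, ?_⟩
  rw [leadingCoeff, coeff_of_leads_scale hA, hr, hk]

/-- If the leading forms of `F` and `G` at a positive weight `s` are proportional up to the powers
`e` and `d`, then the relation between the top corners passes to the bottom corners, which are the
top corners at the weights slightly below `s`. -/
lemma CornersMatch.exists_lt (hd : 0 < d) (he : 0 < e) {s : ℝ} (hs : 0 < s)
    (hstep : ∀ A B f g, Leads (scale s F) A f → Leads (scale s G) B g → f ≠ 0 → g ≠ 0 →
      0 < A → 0 < B → (e : ℝ) * A = d * B →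
      C (d : ℂ) * f * derivative g = derivative f * (C (e : ℂ) * g))
    (hpos : ∃ k : ℕ, 0 < k ∧ bicoeff F 0 k ≠ 0) (h : CornersMatch d e α β F G s) :
    ∃ t, 0 ≤ t ∧ t < s ∧ CornersMatch d e α β F G t := by
  obtain ⟨r, k, r', k', hF, hG, hr, hk, hc⟩ := h
  obtain ⟨f, hf, hFf, hfk, hfl⟩ := hF.leads
  obtain ⟨g, hg, hGg, hgk, hgl⟩ := hG.leads
  have hdR : (0 : ℝ) < d := by exact_mod_cast hd
  have heR : (0 : ℝ) < e := by exact_mod_cast he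
  have hkR : (e : ℝ) * k = d * k' := by exact_mod_cast hk
  have hA : 0 < r + s * k := by
    obtain ⟨k₀, hk₀, h0⟩ := hpos
    have := weight_le_of_leads_scale hFf h0
    have : 0 < s * k₀ := mul_pos hs (by exact_mod_cast hk₀)
    linarith
  have hAB : (e : ℝ) * (r + s * k) = d * (r' + s * k') := by
    linear_combination hr + s * hkR
  have hB : 0 < r' + s * k' := by
    have : 0 < (d : ℝ) * (r' + s * k') := hAB ▸ mul_pos heR hA
    exact (mul_pos_iff_of_pos_left hdR).1 this
  have hprop := pow_proportional hd he hf hg (hstep _ _ f g hFf hGg hf hg hA hB hAB)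
  have hlg : g.leadingCoeff ^ d ≠ 0 := pow_ne_zero _ (leadingCoeff_ne_zero.2 hg)
  obtain ⟨htd, htc⟩ := trailing_of_pow_proportional hf hg
    (pow_ne_zero _ (leadingCoeff_ne_zero.2 hf)) hlg hprop
  have hbF := isBottom_of_leads_scale hFf hf
  have hbG := isBottom_of_leads_scale hGg hg
  have hev : ∀ᶠ t in 𝓝[<] s, 0 < t ∧ t < s :=
    Filter.Eventually.and ((lt_mem_nhds hs).filter_mono nhdsWithin_le_nhds) self_mem_nhdsWithin
  obtain ⟨t, ⟨ht0, hts⟩, htF, htG⟩ := (hev.and (hbF.eventually.and hbG.eventually)).exists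
  refine ⟨t, ht0.le, hts, _, _, _, _, htF, htG, ?_, htd, ?_⟩
  · have htdR : (e : ℝ) * f.natTrailingDegree = d * g.natTrailingDegree := by exact_mod_cast htd
    linear_combination hAB - s * htdR
  · rw [← coeff_of_leads_scale hFf, ← coeff_of_leads_scale hGg]
    change β ^ d * f.trailingCoeff ^ e = α ^ e * g.trailingCoeff ^ d
    rw [← hfl, ← hgl] at hc
    refine mul_left_cancel₀ hlg ?_
    linear_combination β ^ d * htc + g.trailingCoeff ^ d * hc

/-- The relation between the top corners descends from a weight `s₀` to the weight `0`: the
infimum of the weights in `[0, s₀]` where it holds is attained, and it cannot be positive. -/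
theorem CornersMatch.zero (hd : 0 < d) (he : 0 < e) {s₀ : ℝ} (hs₀ : 0 ≤ s₀)
    (hstep : ∀ s, 0 < s → s ≤ s₀ → ∀ A B f g, Leads (scale s F) A f → Leads (scale s G) B g →
      f ≠ 0 → g ≠ 0 → 0 < A → 0 < B → (e : ℝ) * A = d * B →
      C (d : ℂ) * f * derivative g = derivative f * (C (e : ℂ) * g))
    (hpos : ∃ k : ℕ, 0 < k ∧ bicoeff F 0 k ≠ 0) (h : CornersMatch d e α β F G s₀) :
    CornersMatch d e α β F G 0 := by
  set T : Set ℝ := {s | 0 ≤ s ∧ s ≤ s₀ ∧ CornersMatch d e α β F G s} with hT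
  have hne : T.Nonempty := ⟨s₀, hs₀, le_rfl, h⟩
  have hbdd : BddBelow T := ⟨0, fun s hs => hs.1⟩
  set i := sInf T with hi
  have hi0 : 0 ≤ i := le_csInf hne fun s hs => hs.1
  have hi₀ : i ≤ s₀ := csInf_le hbdd ⟨hs₀, le_rfl, h⟩
  obtain ⟨t₀, ht₀⟩ := hne
  have hF : F ≠ 0 := by
    obtain ⟨k, _, hk⟩ := hpos
    rintro rfl
    exact hk (by simp [bicoeff])
  have hG : G ≠ 0 := by
    obtain ⟨_, _, _, _, _, hG, _⟩ := h
    rintro rfl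
    exact hG.1 (by simp [bicoeff])
  have hmem : i ∈ T := by
    by_contra hni
    obtain ⟨A, f, hf, hA⟩ := exists_leads (scale_ne_zero (s := i) hF)
    obtain ⟨B, g, hg, hB⟩ := exists_leads (scale_ne_zero (s := i) hG)
    have hev := (isTop_of_leads_scale hA hf).eventually.and (isTop_of_leads_scale hB hg).eventually
    -- the top corners do not change to the right of `i`, where there are elements of `T`
    have hfreq : ∃ᶠ t in 𝓝[>] i, t ∈ T := by
      rw [Filter.frequently_iff]
      intro U hU
      obtain ⟨u, hu, hsub⟩ := mem_nhdsGT_iff_exists_Ioo_subset.1 hU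
      obtain ⟨t, ht, htu⟩ := exists_lt_of_csInf_lt ⟨t₀, ht₀⟩ (show sInf T < u from hu)
      have hit : i ≤ t := csInf_le hbdd ht
      have hne : i ≠ t := fun h => hni (h ▸ ht)
      exact ⟨t, hsub ⟨lt_of_le_of_ne hit hne, htu⟩, ht⟩
    obtain ⟨t, ⟨_, _, r, k, r', k', hFt, hGt, hr, hk, hc⟩, hFi, hGi⟩ :=
      (hfreq.and_eventually hev).exists
    obtain ⟨rfl, rfl⟩ := hFt.unique hFi
    obtain ⟨rfl, rfl⟩ := hGt.unique hGi
    exact hni ⟨hi0, hi₀, _, _, _, _, isTop_of_leads_scale hA hf, isTop_of_leads_scale hB hg,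
      hr, hk, hc⟩
  rcases hi0.eq_or_lt with h0 | hlt
  · rw [h0]; exact hmem.2.2
  · obtain ⟨t, ht0, hti, ht⟩ := hmem.2.2.exists_lt hd he hlt (hstep i hlt hi₀) hpos
    exact absurd (csInf_le hbdd ⟨ht0, hti.le.trans hi₀, ht⟩) (not_le.2 hti)

end Descent

/-! ### Series with rational exponents -/

/-- The inclusion of the sums with rational exponents into those with real exponents. -/
def embed : FracPoly →ₐ[ℂ] RealPoly :=
  AddMonoidAlgebra.mapDomainAlgHom ℂ ℂ[X] (Rat.castHom ℝ).toAddMonoidHom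

lemma embed_mono (r : ℚ) (c : ℂ[X]) : embed (mono r c) = term r c := by
  simp [embed, mono]

lemma coeff_embed (F : FracPoly) (r : ℚ) : (embed F).coeff (r : ℝ) = F.coeff r := by
  have h : Function.Injective (Rat.castHom ℝ).toAddMonoidHom := fun a b h => Rat.cast_injective h
  exact Finsupp.mapDomain_apply h F.coeff r

lemma leads_embed {F : FracPoly} {a : ℚ} (h : ∀ r, a < r → F.coeff r = 0) :
    Leads (embed F) a (F.coeff a) := by
  refine ⟨coeff_embed F a, fun r hr => ?_⟩
  by_cases hmem : ∃ q : ℚ, (q : ℝ) = r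
  · obtain ⟨q, rfl⟩ := hmem
    rw [coeff_embed, h q (by exact_mod_cast hr)]
  · exact Finsupp.mapDomain_of_notMem_range F.coeff r hmem

lemma HasLeadingTerm.leads {P : MvPolynomial (Fin 2) ℂ} {φ : Series} {a : ℤ} {p : ℂ[X]}
    (h : HasLeadingTerm P φ a p) : Leads (embed (along P φ)) ((a : ℝ) / φ.m) p := by
  have := leads_embed h.2.2
  rw [h.2.1] at this
  exact_mod_cast this

lemma exists_coeff_ne_zero {F : FracPoly} (hF : F ≠ 0) :
    ∃ a, F.coeff a ≠ 0 ∧ ∀ r, a < r → F.coeff r = 0 := by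
  have hs : F.coeff.support.Nonempty := by
    rw [Finsupp.support_nonempty_iff]
    exact fun h => hF (AddMonoidAlgebra.coeff_eq_zero.1 h)
  refine ⟨F.coeff.support.max' hs, ?_, fun r hr => ?_⟩
  · exact Finsupp.mem_support_iff.1 (Finset.max'_mem _ hs)
  · by_contra h
    exact absurd (Finset.le_max' _ r (Finsupp.mem_support_iff.2 h)) (not_le.2 hr)

/-- The exponents of `P(x, φ(x, ξ))` lie in `(1 / m_φ) ℤ`. -/
lemma exists_int_of_coeff_along_ne_zero (P : MvPolynomial (Fin 2) ℂ) (φ : Series) {r : ℚ}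
    (hr : (along P φ).coeff r ≠ 0) : ∃ J : ℤ, r = J / φ.m := by
  let i : ℤ →+ ℚ := (AddMonoidHom.mulRight ((φ.m : ℚ)⁻¹)).comp (Int.castAddHom ℚ)
  have hm : (φ.m : ℚ) ≠ 0 := by exact_mod_cast φ.m_pos.ne'
  let I : AddMonoidAlgebra ℂ[X] ℤ →ₐ[ℂ] FracPoly := AddMonoidAlgebra.mapDomainAlgHom ℂ ℂ[X] i
  have hI : ∀ (z : ℤ) (t : ℚ) (c : ℂ[X]), t = z / φ.m → mono t c ∈ I.range := by
    rintro z t c rfl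
    refine ⟨AddMonoidAlgebra.single z c, ?_⟩
    exact AddMonoidAlgebra.mapDomain_single
  have hgen : ∀ j, (![mono 1 1, φ.toFracPoly] : Fin 2 → FracPoly) j ∈ I.range := by
    intro j
    fin_cases j
    · exact hI φ.m 1 1 (by field_simp; simp)
    · refine add_mem (sum_mem fun k _ => hI (φ.m - k) _ _ ?_) (mul_mem (hI 0 0 X (by simp))
        (hI (φ.m - φ.n) _ _ ?_)) <;> (push_cast; field_simp)
  have hmem : along P φ ∈ I.range := by
    choose u hu using hgen
    refine ⟨MvPolynomial.aeval u P, ?_⟩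
    change I (MvPolynomial.aeval u P) = _
    rw [along, MvPolynomial.comp_aeval_apply]
    exact congrArg (fun v => MvPolynomial.aeval v P) (funext hu)
  obtain ⟨F, hF⟩ := hmem
  by_contra hne
  refine hr ?_
  rw [← hF]
  refine Finsupp.mapDomain_of_notMem_range F.coeff r ?_
  rintro ⟨z, hz⟩
  exact hne ⟨z, by rw [← hz]; simp [i, div_eq_mul_inv]⟩

namespace Series

/-- The exponent of the parameter term. -/
def paramExp (φ : Series) : ℚ := 1 - (φ.n : ℚ) / φ.m

/-- The terms of the series without the parameter. -/
def base (φ : Series) : FracPoly :=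
  ∑ k : Fin φ.n, mono (1 - (k : ℚ) / φ.m) (C (φ.a k))

lemma subst_eq (φ : Series) (η : FracPoly) : φ.subst η = φ.base + η * mono φ.paramExp 1 := rfl

lemma mono_mul_mono (r s : ℚ) (c d : ℂ[X]) : mono r c * mono s d = mono (r + s) (c * d) :=
  AddMonoidAlgebra.single_mul_single _ _ _ _

lemma base_mul_mono (φ : Series) (t : ℚ) :
    φ.base * mono t 1 = ∑ k : Fin φ.n, mono (1 - (k : ℚ) / φ.m + t) (C (φ.a k)) := by
  simp only [base, Finset.sum_mul, mono_mul_mono, mul_one]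

lemma coeff_base_mul_mono (φ : Series) (t r : ℚ) : ((φ.base * mono t 1).coeff r).coeff 1 = 0 := by
  rw [base_mul_mono, AddMonoidAlgebra.coeff_sum, Finsupp.finsetSum_apply, finsetSum_coeff]
  refine Finset.sum_eq_zero fun k _ => ?_
  classical
  rw [mono, AddMonoidAlgebra.coeff_single, Finsupp.single_apply]
  split_ifs <;> simp

lemma substParam_base_mul_mono (φ : Series) (t : ℚ) (ζ : RealPoly) :
    substParam ζ (embed (φ.base * mono t 1)) = embed (φ.base * mono t 1) := by
  simp only [base_mul_mono, map_sum, embed_mono]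
  refine Finset.sum_congr rfl fun k _ => ?_
  rw [substParam_term, aeval_C]
  change AddMonoidAlgebra.single 0 (C _) * AddMonoidAlgebra.single _ 1 = _
  rw [AddMonoidAlgebra.single_mul_single, zero_add, mul_one]

lemma substParam_base (φ : Series) (ζ : RealPoly) :
    substParam ζ (embed φ.base) = embed φ.base := by
  have h := φ.substParam_base_mul_mono 0 ζ
  rwa [show (mono 0 1 : FracPoly) = 1 from rfl, mul_one] at h

lemma paramDeriv_base (φ : Series) : paramDeriv (embed φ.base) = 0 := by
  simp only [base, map_sum, embed_mono, paramDeriv_term, derivative_C]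
  simp [term]

lemma embed_toFracPoly (φ : Series) :
    embed φ.toFracPoly = embed φ.base + term φ.paramExp X := by
  rw [toFracPoly, subst_eq, mono_mul_mono, map_add, embed_mono, zero_add, mul_one]

lemma substParam_toFracPoly (φ : Series) (ζ : RealPoly) :
    substParam ζ (embed φ.toFracPoly) = embed φ.base + ζ * term φ.paramExp 1 := by
  rw [embed_toFracPoly, map_add, substParam_base, substParam_term, aeval_X]

/-- If `ψ ≺ φ`, then `φ(x, ξ) = ψ(x, K(x) + ξ x^(-s))` with `s > 0`, where `K` does not involve `ξ`
and has only nonpositive exponents. -/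
lemma Prec.exists_shift {ψ φ : Series} (h : ψ.Prec φ) :
    ∃ (c : ℂ) (K : RealPoly) (s : ℝ), 0 < s ∧
      (∀ ζ, substParam ζ K = K) ∧ Leads K 0 (C c) ∧
      embed φ.toFracPoly = embed ψ.base + (K + term (-s) X) * term ψ.paramExp 1 := by
  obtain ⟨c, η, hη, h⟩ := h
  set Z : FracPoly := mono 0 (C c) + η with hZ
  set K : FracPoly := φ.base * mono (-ψ.paramExp) 1 - ψ.base * mono (-ψ.paramExp) 1 with hK
  have hunit : (mono ψ.paramExp 1 : FracPoly) * mono (-ψ.paramExp) 1 = 1 := by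
    rw [mono_mul_mono, add_neg_cancel, mul_one]; rfl
  have hZK : Z = K + mono (φ.paramExp - ψ.paramExp) X := by
    rw [toFracPoly, subst_eq, subst_eq] at h
    have hX : (mono (φ.paramExp - ψ.paramExp) X : FracPoly)
        = mono 0 X * mono φ.paramExp 1 * mono (-ψ.paramExp) 1 := by
      rw [mono_mul_mono, mono_mul_mono, zero_add, mul_one, mul_one, sub_eq_add_neg]
    rw [hX, hK]
    linear_combination (-mono (-ψ.paramExp) 1) * h - Z * hunit
  have hZc : ∀ r, 0 ≤ r → Z.coeff r = if r = 0 then C c else 0 := by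
    intro r hr
    classical
    rw [hZ, AddMonoidAlgebra.coeff_add, Finsupp.add_apply, hη r hr, add_zero, mono,
      AddMonoidAlgebra.coeff_single, Finsupp.single_apply]
    simp only [eq_comm]
  have hlt : φ.paramExp < ψ.paramExp := by
    -- otherwise `ξ` would occur in `Z` with a nonnegative exponent of `x`
    by_contra hge
    have h1 := congrArg (fun F : FracPoly => (F.coeff (φ.paramExp - ψ.paramExp)).coeff 1) hZK
    simp only [hK, AddMonoidAlgebra.coeff_add, AddMonoidAlgebra.coeff_sub, Finsupp.add_apply,
      Finsupp.sub_apply, coeff_add, coeff_sub, coeff_base_mul_mono] at h1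
    rw [hZc _ (by linarith)] at h1
    split_ifs at h1 <;> simp [mono] at h1
  have hembZ : embed Z = embed K + term (-((ψ.paramExp - φ.paramExp : ℚ) : ℝ)) X := by
    rw [hZK, map_add, embed_mono]
    congr 2
    push_cast; ring
  have hpos : (0 : ℝ) < ((ψ.paramExp - φ.paramExp : ℚ) : ℝ) := by
    exact_mod_cast sub_pos.2 hlt
  refine ⟨c, embed K, ((ψ.paramExp - φ.paramExp : ℚ) : ℝ), hpos, fun ζ => ?_,
    ?_, ?_⟩
  · simp only [hK, map_sub, substParam_base_mul_mono]
  · have h1 : Leads (embed Z) 0 (C c) := by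
      have := leads_embed (F := Z) (a := 0) fun r hr => by rw [hZc r hr.le, if_neg hr.ne']
      rw [hZc 0 le_rfl, if_pos rfl] at this
      exact_mod_cast this
    have h2 : embed K = embed Z - term (-((ψ.paramExp - φ.paramExp : ℚ) : ℝ)) X := by
      rw [hembZ]; ring
    rw [h2]
    simpa using h1.sub ((leads_term _ X).mono (neg_lt_zero.2 hpos))
  · rw [h, subst_eq, map_add, map_mul, hembZ, embed_mono]

end Series

lemma map_embed_along (f : RealPoly →ₐ[ℂ] RealPoly) (hf : f (term 1 1) = term 1 1)
    (P : MvPolynomial (Fin 2) ℂ) (φ : Series) :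
    f (embed (along P φ)) = MvPolynomial.aeval ![term 1 1, f (embed φ.toFracPoly)] P := by
  rw [along, MvPolynomial.comp_aeval_apply, MvPolynomial.comp_aeval_apply]
  refine congrArg (fun v => MvPolynomial.aeval v P) (funext fun j => ?_)
  fin_cases j
  · simp [embed_mono, hf]
  · simp

/-! ### Leading forms along a series -/

lemma scale_along (s : ℝ) (P : MvPolynomial (Fin 2) ℂ) (φ : Series) :
    scale s (embed (along P φ)) =
      MvPolynomial.aeval ![term 1 1, embed φ.base + term (s + φ.paramExp) X] P := by
  have h1 : scale s (term 1 1) = term 1 1 := by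
    rw [substParam_term, map_one, one_mul]
  rw [map_embed_along _ h1, φ.substParam_toFracPoly]
  simp only [term, AddMonoidAlgebra.single_mul_single, mul_one]

/-- If `J(P, Q)` has a constant leading coefficient after `ξ ↦ ξ x^s`, then the leading
coefficients `f`, `g` of `P`, `Q` with exponents `A, B > 0` satisfy `A f g' = B f' g`. Indeed, all
the exponents of `P(x, φ)` and `Q(x, φ)` are nonpositive, hence `f` and `g` vanish at `0`, and so
does `A f g' - B f' g`, which is either zero or the leading coefficient of the Jacobian. -/
lemma mul_derivative_eq_of_leads {P Q : MvPolynomial (Fin 2) ℂ} {φ : Series} {s : ℝ}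
    (hJ : scale s (embed (along (jacobian P Q) φ)) = 0 ∨
      ∃ r j, j ≠ 0 ∧ Leads (scale s (embed (along (jacobian P Q) φ))) r (C j))
    (hP : ∀ r, 0 < r → (embed (along P φ)).coeff r = 0)
    (hQ : ∀ r, 0 < r → (embed (along Q φ)).coeff r = 0)
    {A B : ℝ} {f g : ℂ[X]} (hf : Leads (scale s (embed (along P φ))) A f)
    (hg : Leads (scale s (embed (along Q φ))) B g) (hA : 0 < A) (hB : 0 < B) :
    C (A : ℂ) * f * derivative g = derivative f * (C (B : ℂ) * g) := by
  have hf0 : f.coeff 0 = 0 := by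
    rw [coeff_of_leads_scale hf, Nat.cast_zero, mul_zero, sub_zero, bicoeff, hP A hA, coeff_zero]
  have hg0 : g.coeff 0 = 0 := by
    rw [coeff_of_leads_scale hg, Nat.cast_zero, mul_zero, sub_zero, bicoeff, hQ B hB, coeff_zero]
  have hW := hf.wronskian hg
  rw [scale_along, scale_along, jacobian_chain, ← scale_along, map_add, φ.paramDeriv_base,
    zero_add, paramDeriv_term, derivative_X] at hW
  simp only [term, AddMonoidAlgebra.single_mul_single, mul_one] at hW
  rw [← sub_eq_zero]
  rcases hJ with hJ | ⟨r, j, hj, hJ⟩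
  · rw [hJ, zero_mul] at hW
    exact hW.1.symm
  · by_contra hne
    have hJ' := hJ.mul (leads_term (1 + (s + φ.paramExp)) 1)
    rw [mul_one] at hJ'
    have hj' : (C j : ℂ[X]) ≠ 0 := C_ne_zero.2 hj
    have heq := hW.unique hne hJ' hj'
    have hWj := hW.1.symm.trans (heq ▸ hJ'.1)
    have := congrArg (fun p : ℂ[X] => p.coeff 0) hWj
    simp only [coeff_sub, mul_coeff_zero, hf0, hg0, coeff_C_zero] at this
    exact hj (by simpa using this.symm)

lemma leads_jacobian_of_not_isSingular {P Q : MvPolynomial (Fin 2) ℂ} {ψ : Series}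
    (hψ : ¬ IsSingular P Q ψ) : along (jacobian P Q) ψ = 0 ∨
      ∃ r j, j ≠ 0 ∧ Leads (embed (along (jacobian P Q) ψ)) r (C j) := by
  by_cases h0 : along (jacobian P Q) ψ = 0
  · exact Or.inl h0
  obtain ⟨a, ha, hlt⟩ := exists_coeff_ne_zero h0
  obtain ⟨J, rfl⟩ := exists_int_of_coeff_along_ne_zero _ _ ha
  have hdeg : ((along (jacobian P Q) ψ).coeff (J / ψ.m)).natDegree = 0 := by
    by_contra hne
    exact hψ ⟨J, _, ⟨ha, rfl, hlt⟩, Nat.pos_of_ne_zero hne⟩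
  rw [natDegree_eq_zero] at hdeg
  obtain ⟨j, hj⟩ := hdeg
  refine Or.inr ⟨_, j, ?_, hj ▸ leads_embed hlt⟩
  rintro rfl
  exact ha (by rw [← hj, C_0])

/-- Substituting a suitable `ζ = K + ξ x^(s - s₀)` into the expansion along `ψ` gives the scaled
expansion along `φ`. -/
lemma scale_along_eq_substParam {ψ φ : Series} {K : RealPoly} {s₀ : ℝ}
    (hK : ∀ ζ, substParam ζ K = K)
    (h : embed φ.toFracPoly = embed ψ.base + (K + term (-s₀) X) * term ψ.paramExp 1)
    (s : ℝ) (P : MvPolynomial (Fin 2) ℂ) :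
    scale s (embed (along P φ)) = substParam (K + term (s - s₀) X) (embed (along P ψ)) := by
  have h1 : ∀ ζ (r : ℝ), substParam ζ (term r 1) = term r 1 := fun ζ r => by
    rw [substParam_term, map_one, one_mul]
  rw [map_embed_along _ (h1 _ _), map_embed_along _ (h1 _ _), ψ.substParam_toFracPoly, h, map_add,
    map_mul, map_add, ψ.substParam_base, hK, h1, substParam_term, aeval_X]
  simp only [term, AddMonoidAlgebra.single_mul_single, mul_one]
  rw [sub_eq_add_neg]

lemma exists_eq_pow_of_pow_eq_pow {u v : ℂ} (hu : u ≠ 0) (hv : v ≠ 0) {d e : ℕ}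
    (hde : Nat.gcd d e = 1) (h : u ^ e = v ^ d) :
    ∃ c : ℂ, c ≠ 0 ∧ u = c ^ d ∧ v = c ^ e := by
  have hbez := Nat.gcd_eq_gcd_ab d e
  rw [hde] at hbez
  set x := Nat.gcdA d e
  set y := Nat.gcdB d e
  have hz : u ^ (e : ℤ) = v ^ (d : ℤ) := by simpa using h
  refine ⟨u ^ x * v ^ y, mul_ne_zero (zpow_ne_zero _ hu) (zpow_ne_zero _ hv), ?_, ?_⟩
  · rw [← zpow_natCast, mul_zpow, ← zpow_mul, ← zpow_mul, mul_comm y, zpow_mul v, ← hz, ← zpow_mul,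
      ← zpow_add₀ hu, mul_comm x, ← hbez]
    simp
  · rw [← zpow_natCast, mul_zpow, ← zpow_mul, ← zpow_mul, mul_comm x, zpow_mul u, hz, ← zpow_mul,
      ← zpow_add₀ hv, mul_comm y, ← hbez]
    simp

lemma exists_mul_of_mul_eq_mul {a b d e : ℕ} (hd : 0 < d) (hde : Nat.gcd d e = 1)
    (h : e * a = d * b) : ∃ N, a = N * d ∧ b = N * e := by
  obtain ⟨N, rfl⟩ := (Nat.Coprime.dvd_of_dvd_mul_left hde (Dvd.intro b h.symm) : d ∣ a)
  exact ⟨N, mul_comm _ _, Nat.eq_of_mul_eq_mul_left hd (by rw [← h]; ring)⟩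

/-- The theorem for a horizontal series of `P`, to which the case of a horizontal series of `Q`
reduces by symmetry. -/
theorem of_isHorizontal_left {P Q : MvPolynomial (Fin 2) ℂ} {ψ φ : Series}
    {aψ bψ : ℤ} {pψ qψ : ℂ[X]} (hPψ : HasLeadingTerm P ψ aψ pψ) (hQψ : HasLeadingTerm Q ψ bψ qψ)
    (ha : 0 < aψ) (hb : 0 < bψ) {M d e : ℕ} (haM : aψ = M * d) (hbM : bψ = M * e)
    (hde : Nat.gcd d e = 1) (hφ : IsHorizontal P φ) {b : ℤ} {q : ℂ[X]}
    (hQφ : HasLeadingTerm Q φ b q) (hb0 : b ≤ 0) (hψφ : ψ.Prec φ) (hψ : ¬ IsSingular P Q ψ) :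
    (∃ N : ℕ, 0 < N ∧ pψ.natDegree = N * d ∧ qψ.natDegree = N * e) ∧
    (∃ pφ qφ : ℂ[X], HasLeadingTerm P φ 0 pφ ∧ HasLeadingTerm Q φ 0 qφ ∧
      ∃ (c : ℂ) (D : ℕ), c ≠ 0 ∧ 0 < D ∧
        pφ.natDegree = D * d ∧ pφ.leadingCoeff = pψ.leadingCoeff * c ^ d ∧
        qφ.natDegree = D * e ∧ qφ.leadingCoeff = qψ.leadingCoeff * c ^ e) := by
  obtain ⟨p, hPφ, hp⟩ := hφ
  have hd : 0 < d := Nat.pos_of_ne_zero (by rintro rfl; simp at haM; omega)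
  have he : 0 < e := Nat.pos_of_ne_zero (by rintro rfl; simp at hbM; omega)
  have hdR : (d : ℝ) ≠ 0 := by exact_mod_cast hd.ne'
  have heR : (e : ℝ) ≠ 0 := by exact_mod_cast he.ne'
  have hmφ : (0 : ℝ) < φ.m := by exact_mod_cast φ.m_pos
  have hmψ : (0 : ℝ) < ψ.m := by exact_mod_cast ψ.m_pos
  obtain ⟨c, K, s₀, hs₀, hK, hK0, hshift⟩ := hψφ.exists_shift
  have hsub := scale_along_eq_substParam hK hshift
  set F := embed (along P φ) with hF
  set G := embed (along Q φ) with hG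
  have hFl : Leads F 0 p := by simpa using hPφ.leads
  have hGl : Leads G (b / φ.m) q := hQφ.leads
  have hG0 : ∀ r : ℝ, 0 < r → G.coeff r = 0 := fun r hr =>
    hGl.2 r (lt_of_le_of_lt (div_nonpos_of_nonpos_of_nonneg (by exact_mod_cast hb0) hmφ.le) hr)
  -- for `0 < s ≤ s₀` the substituted `ζ` has nonpositive exponents
  have hζ : ∀ s, s ≤ s₀ → ∃ z, Leads (K + term (s - s₀) X) 0 z := by
    intro s hs
    rcases hs.lt_or_eq with hlt | rfl
    · exact ⟨_, hK0.add ((leads_term _ X).mono (sub_neg.2 hlt))⟩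
    · exact ⟨_, hK0.add (by simpa using leads_term 0 X)⟩
  have hJ : ∀ s, s ≤ s₀ → scale s (embed (along (jacobian P Q) φ)) = 0 ∨
      ∃ r j, j ≠ 0 ∧ Leads (scale s (embed (along (jacobian P Q) φ))) r (C j) := by
    intro s hs
    obtain ⟨z, hz⟩ := hζ s hs
    rw [hsub]
    rcases leads_jacobian_of_not_isSingular hψ with h0 | ⟨r, j, hj, hl⟩
    · left; rw [h0, map_zero, map_zero]
    · right; exact ⟨r, j, hj, by simpa using hz.substParam hl⟩
  have hstep : ∀ s, 0 < s → s ≤ s₀ → ∀ A B f g, Leads (scale s F) A f → Leads (scale s G) B g →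
      f ≠ 0 → g ≠ 0 → 0 < A → 0 < B → (e : ℝ) * A = d * B →
      C (d : ℂ) * f * derivative g = derivative f * (C (e : ℂ) * g) := by
    intro s _ hs A B f g hf hg _ _ hA hB hAB
    have h := mul_derivative_eq_of_leads (hJ s hs) hFl.2 hG0 hf hg hA hB
    have hABC : (C (e : ℂ) * C (A : ℂ) : ℂ[X]) = C (d : ℂ) * C (B : ℂ) := by
      rw [← C_mul, ← C_mul]
      exact congrArg C (by exact_mod_cast hAB)
    refine mul_left_cancel₀ (C_ne_zero.2 (Complex.ofReal_ne_zero.2 hB.ne')) ?_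
    linear_combination C (e : ℂ) * h - f * derivative g * hABC
  -- the weight `s₀` reproduces the leading coefficients along `ψ`, shifted by `c`
  have hζ₀ : Leads (K + term (s₀ - s₀) X) 0 (C c + X) :=
    hK0.add (by simpa using leads_term 0 X)
  have hF₀ : Leads (scale s₀ F) (aψ / ψ.m) (pψ.comp (C c + X)) := by
    rw [hF, hsub]; exact hζ₀.substParam hPψ.leads
  have hG₀ : Leads (scale s₀ G) (bψ / ψ.m) (qψ.comp (C c + X)) := by
    rw [hG, hsub]; exact hζ₀.substParam hQψ.leads
  have hdegX : (C c + X : ℂ[X]).natDegree = 1 := by rw [add_comm]; exact natDegree_X_add_C c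
  have hlcX : (C c + X : ℂ[X]).leadingCoeff = 1 := by rw [add_comm]; exact leadingCoeff_X_add_C c
  have hdegc : ∀ h : ℂ[X], (h.comp (C c + X)).natDegree = h.natDegree := fun h => by
    rw [natDegree_comp, hdegX, mul_one]
  have hlcc : ∀ h : ℂ[X], (h.comp (C c + X)).leadingCoeff = h.leadingCoeff := fun h => by
    rw [leadingCoeff_comp (by rw [hdegX]; exact one_ne_zero), hlcX, one_pow, mul_one]
  have hne : ∀ h : ℂ[X], h ≠ 0 → h.comp (C c + X) ≠ 0 := fun h hh => by
    rw [← leadingCoeff_ne_zero, hlcc]; exact leadingCoeff_ne_zero.2 hh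
  have hA₀ : (0 : ℝ) < aψ / ψ.m := div_pos (by exact_mod_cast ha) hmψ
  have hB₀ : (0 : ℝ) < bψ / ψ.m := div_pos (by exact_mod_cast hb) hmψ
  have hAB₀ : (e : ℝ) * (aψ / ψ.m) = d * (bψ / ψ.m) := by
    rw [haM, hbM]; push_cast; ring
  have hprop := pow_proportional hd he (hne _ hPψ.1) (hne _ hQψ.1)
    (hstep s₀ hs₀ le_rfl _ _ _ _ hF₀ hG₀ (hne _ hPψ.1) (hne _ hQψ.1) hA₀ hB₀ hAB₀)
  have hα : pψ.leadingCoeff ≠ 0 := leadingCoeff_ne_zero.2 hPψ.1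
  have hβ : qψ.leadingCoeff ≠ 0 := leadingCoeff_ne_zero.2 hQψ.1
  have hdeg₀ : e * pψ.natDegree = d * qψ.natDegree := by
    have := congrArg natDegree hprop
    rwa [hlcc, hlcc, natDegree_C_mul (pow_ne_zero _ hβ), natDegree_C_mul (pow_ne_zero _ hα),
      natDegree_pow, natDegree_pow, hdegc, hdegc] at this
  have hmatch : CornersMatch d e pψ.leadingCoeff qψ.leadingCoeff F G s₀ := by
    have hTF := isTop_of_leads_scale hF₀ (hne _ hPψ.1)
    have hTG := isTop_of_leads_scale hG₀ (hne _ hQψ.1)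
    refine ⟨_, _, _, _, hTF, hTG, ?_, ?_, ?_⟩
    · rw [hdegc, hdegc]
      have : (e : ℝ) * pψ.natDegree = d * qψ.natDegree := by exact_mod_cast hdeg₀
      linear_combination hAB₀ - s₀ * this
    · rw [hdegc, hdegc, hdeg₀]
    · rw [← coeff_of_leads_scale hF₀, ← coeff_of_leads_scale hG₀, coeff_natDegree,
        coeff_natDegree, hlcc, hlcc]
      ring
  have hpos : ∃ k : ℕ, 0 < k ∧ bicoeff F 0 k ≠ 0 :=
    ⟨p.natDegree, hp, by rw [bicoeff, hFl.1]; exact leadingCoeff_ne_zero.2 hPφ.1⟩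
  obtain ⟨r, k, r', k', hTF, hTG, hr, hk, hc⟩ := hmatch.zero hd he hs₀.le hstep hpos
  -- at the weight `0` the top corners are the leading terms of `p_φ` and `q_φ`
  obtain ⟨hrF, hkF⟩ := hTF.unique
    (isTop_of_leads_scale (s := 0) (by rw [scale_zero]; exact hFl) hPφ.1)
  obtain ⟨hrG, hkG⟩ := hTG.unique
    (isTop_of_leads_scale (s := 0) (by rw [scale_zero]; exact hGl) hQφ.1)
  rw [zero_mul, sub_zero] at hrF hrG
  have hr'0 : r' = 0 := by
    rw [hrF, mul_zero] at hr
    exact (mul_eq_zero.1 hr.symm).resolve_left hdR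
  have hbz : b = 0 := by
    rw [hr'0] at hrG
    have := (div_eq_zero_iff.1 hrG.symm).resolve_right hmφ.ne'
    exact_mod_cast this
  subst hbz
  constructor
  · obtain ⟨N, hN, hN'⟩ := exists_mul_of_mul_eq_mul hd hde hdeg₀
    refine ⟨N, Nat.pos_of_ne_zero ?_, hN, hN'⟩
    -- a constant `p_ψ` would give a nonzero leading coefficient of `F` in a positive exponent
    rintro rfl
    have h0 : (pψ.comp (C c + X)).coeff 0 = 0 := by
      rw [coeff_of_leads_scale hF₀, Nat.cast_zero, mul_zero, sub_zero, bicoeff, hFl.2 _ hA₀,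
        coeff_zero]
    apply leadingCoeff_ne_zero.2 (hne _ hPψ.1)
    rwa [leadingCoeff, hdegc, hN, zero_mul]
  · rw [hkF, hkG] at hk
    have hpl : bicoeff F r k = p.leadingCoeff := by rw [bicoeff, hrF, hFl.1, hkF]; rfl
    have hql : bicoeff G r' k' = q.leadingCoeff := by rw [bicoeff, hrG, hGl.1, hkG]; rfl
    rw [hpl, hql] at hc
    obtain ⟨D, hD, hD'⟩ := exists_mul_of_mul_eq_mul hd hde hk
    obtain ⟨w, hw, hwp, hwq⟩ := exists_eq_pow_of_pow_eq_pow
      (div_ne_zero (leadingCoeff_ne_zero.2 hPφ.1) hα)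
      (div_ne_zero (leadingCoeff_ne_zero.2 hQφ.1) hβ) hde (by
        rw [div_pow, div_pow, div_eq_div_iff (pow_ne_zero _ hα) (pow_ne_zero _ hβ)]
        linear_combination hc)
    refine ⟨p, q, hPφ, hQφ, w, D, hw, Nat.pos_of_ne_zero ?_, hD, ?_, hD', ?_⟩
    · rintro rfl
      rw [zero_mul] at hD
      omega
    · rw [← hwp, mul_div_cancel₀ _ hα]
    · rw [← hwq, mul_div_cancel₀ _ hβ]

lemma not_isSingular_swap {P Q : MvPolynomial (Fin 2) ℂ} {ψ : Series} (h : ¬ IsSingular P Q ψ) :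
    ¬ IsSingular Q P ψ := by
  rintro ⟨J, j, ⟨hj, hJ, hlt⟩, hdeg⟩
  have hneg : along (jacobian P Q) ψ = -along (jacobian Q P) ψ := by
    rw [along, along, ← map_neg]
    congr 1
    simp only [jacobian]
    ring
  refine h ⟨J, -j, ⟨neg_ne_zero.2 hj, ?_, fun r hr => ?_⟩, by rwa [natDegree_neg]⟩
  · simp [hneg, hJ]
  · simp [hneg, hlt r hr]

end NewtonPuiseux

end

theorem theorem1
    (P Q : MvPolynomial (Fin 2) ℂ)
    (hP : NewtonPuiseux.MonicInY P) (hQ : NewtonPuiseux.MonicInY Q)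
    (ψ φ : NewtonPuiseux.Series)
    -- the leading terms of `P` and `Q` along `ψ`
    (aψ bψ : ℤ) (pψ qψ : Polynomial ℂ)
    (hPψ : NewtonPuiseux.HasLeadingTerm P ψ aψ pψ)
    (hQψ : NewtonPuiseux.HasLeadingTerm Q ψ bψ qψ)
    (ha : 0 < aψ) (hb : 0 < bψ)
    (M d e : ℕ) (haM : aψ = M * d) (hbM : bψ = M * e) (hde : Nat.gcd d e = 1)
    (hφ : NewtonPuiseux.IsDicritical P Q φ)
    (hψφ : NewtonPuiseux.Series.Prec ψ φ)
    (hψ : ¬ NewtonPuiseux.IsSingular P Q ψ) :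
    (∃ N : ℕ, 0 < N ∧ pψ.natDegree = N * d ∧ qψ.natDegree = N * e) ∧
    (∃ pφ qφ : Polynomial ℂ,
      -- `a_φ = b_φ = 0`, with leading coefficients `p_φ` and `q_φ`
      NewtonPuiseux.HasLeadingTerm P φ 0 pφ ∧ NewtonPuiseux.HasLeadingTerm Q φ 0 qφ ∧
      ∃ (C : ℂ) (D : ℕ), C ≠ 0 ∧ 0 < D ∧
        pφ.natDegree = D * d ∧ pφ.leadingCoeff = pψ.leadingCoeff * C ^ d ∧
        qφ.natDegree = D * e ∧ qφ.leadingCoeff = qψ.leadingCoeff * C ^ e) := by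
  obtain ⟨hor, a, b, p, q, hPφ, hQφ, hmax⟩ := hφ
  rcases hor with hor | hor
  · exact NewtonPuiseux.of_isHorizontal_left hPψ hQψ ha hb haM hbM hde hor hQφ
      (hmax ▸ le_max_right a b) hψφ hψ
  · obtain ⟨⟨N, hN, h1, h2⟩, p', q', hp', hq', c, D, hc, hD, h3, h4, h5, h6⟩ :=
      NewtonPuiseux.of_isHorizontal_left hQψ hPψ hb ha hbM haM (Nat.gcd_comm d e ▸ hde) hor hPφ
        (hmax ▸ le_max_left a b) hψφ (NewtonPuiseux.not_isSingular_swap hψ)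
    exact ⟨⟨N, hN, h2, h1⟩, q', p', hq', hp', c, D, hc, hD, h5, h6, h3, h4⟩
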